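/- Let $(X,d)$ be a complete geodesic metric space with a locally finite Borel measure $\mu$ that is doubling: there is $C\ge 1$ with $\mu(B_{2r}(x))\le C\,\mu(B_r(x))$ for all $x\in X$, $r>0$. Let $\Omega\subsetneq X$ be a bounded domain (a nonempty connected open set). Curves are rectifiable and parametrized by arc length, $\gamma:[0,\ell]\to\overline\Omega$. A null set is a set $N\subset\overline\Omega$ with $\mu(N)=0$, and $\gamma$ is transversal to $N$ if $\mathcal H^1(\gamma^{-1}(N))=0$. Assume that $(\overline\Omega,d,\mu)$ has the $\infty$-weak Fubini property: for every null set $N$, every $\varepsilon>0$ and all distinct $x,y\in\overline\Omega$ there is a curve in $\overline\Omega$ from $x$ to $y$, transversal to $N$, of length at most $d(x,y)+\varepsilon$. Let $f:\overline\Omega\to(0,\infty)$ be Borel measurable with $f\in L^\infty(\overline\Omega)$ and $\inf_\Omega f>0$. For $x,y\in\overline\Omega$ put $$\tilde L_f(x,y)=\sup_{\mu(N)=0}\ \inf_{\gamma}\int_\gamma f\,ds ,$$ where the supremum is over all null sets $N$ and the infimum over all curves $\gamma$ in $\overline\Omega$ from $x$ to $y$ that are transversal to $N$ and satisfy $\int_\gamma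 f\,ds<\infty$. Let $g:\partial\Omega\to\mathbb R$ satisfy $g(x)\le\tilde L_f(x,y)+g(y)$ for all $x,y\in\partial\Omega$, and let $$\tilde u(x)=\inf_{y\in\partial\Omega}\{\tilde L_f(x,y)+g(y)\},\qquad x\in\overline\Omega .$$ Write $|\nabla v|(x)=\limsup_{y\to x}\frac{|v(y)-v(x)|}{d(x,y)}$, and let $S_{weak}$ be the set of weak subsolutions, that is, of all $v:\overline\Omega\to\mathbb R$ that are continuous on $\overline\Omega$, locally Lipschitz in $\Omega$, and satisfy $|\nabla v|\le f$ $\mu$-a.e. in $\Omega$ and $v\le g$ on $\partial\Omega$. Then $\tilde u$ is finite on $\overline\Omega$, and $v\le\tilde u$ in $\overline\Omega$ for every $v\in S_{weak}$. If in addition there is $N\subset\Omega$ with $\mu(N)=0$ such that $f|_{\Omega\setminus N}$ is upper semicontinuous, then $\tilde u\in S_{weak}$; in particular $\tilde u$ is the maximal weak subsolution: $\tilde u(x)=\sup\{v(x): v\in S_{weak}\}$ for all $x\in\Omega$. -/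

import Mathlib

open MeasureTheory Set Filter Topology
open scoped ENNReal NNReal

namespace Eikonal

noncomputable section

/-- Every two points are joined by a curve whose length is their distance. -/
def IsGeodesicSpace (X : Type*) [MetricSpace X] : Prop :=
  ∀ x y : X, ∃ γ : ℝ → X, γ 0 = x ∧ γ (dist x y) = y ∧
    ∀ s ∈ Icc 0 (dist x y), ∀ t ∈ Icc 0 (dist x y), dist (γ s) (γ t) = |s - t|

/-- The doubling property of a measure. -/
def IsDoubling {X : Type*} [MetricSpace X] [MeasurableSpace X] (μ : Measure X) : Prop :=
  ∃ C : ℝ≥0, 1 ≤ C ∧ ∀ (x : X) (r : ℝ), 0 < r →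
    μ (Metric.ball x (2 * r)) ≤ C * μ (Metric.ball x r)

/-- `γ : [0, ℓ] → A` is a rectifiable curve in `A` from `x` to `y`, parametrized by arc length:
its length on `[s, t]` is `t - s` (for rectifiable curves: `γ` is absolutely continuous with
`|γ'| = 1` a.e.). In particular `γ` is `1`-Lipschitz on `[0, ℓ]` and has length `ℓ`.
Only the values of `γ` on `[0, ℓ]` matter. -/
structure IsArcLengthCurve {X : Type*} [MetricSpace X] (A : Set X) (x y : X) (ℓ : ℝ)
    (γ : ℝ → X) : Prop where
  nonneg : 0 ≤ ℓ
  mapsTo : MapsTo γ (Icc 0 ℓ) A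
  unitSpeed : HasUnitSpeedOn γ (Icc 0 ℓ)
  source : γ 0 = x
  target : γ ℓ = y

/-- A curve `γ : [0, ℓ] → X` is transversal to `N` if `ℋ¹(γ⁻¹(N)) = 0`. -/
def IsTransversal {X : Type*} (N : Set X) (ℓ : ℝ) (γ : ℝ → X) : Prop :=
  μH[1] (Icc 0 ℓ ∩ γ ⁻¹' N) = 0

/-- The `∞`-weak Fubini property of the metric measure space `(A, d, μ)`, `A ⊆ X`. -/
def InftyWeakFubini {X : Type*} [MetricSpace X] [MeasurableSpace X] (μ : Measure X)
    (A : Set X) : Prop :=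
  ∀ N ⊆ A, μ N = 0 → ∀ ε : ℝ, 0 < ε → ∀ x ∈ A, ∀ y ∈ A, x ≠ y →
    ∃ (ℓ : ℝ) (γ : ℝ → X), IsArcLengthCurve A x y ℓ γ ∧ IsTransversal N ℓ γ ∧
      ℓ ≤ dist x y + ε

/-- The path integral `∫_γ f ds` of a nonnegative function along an arc-length parametrized
curve `γ : [0, ℓ] → X`. -/
def pathIntegral {X : Type*} (f : X → ℝ) (ℓ : ℝ) (γ : ℝ → X) : ℝ≥0∞ :=
  ∫⁻ s in Icc 0 ℓ, ENNReal.ofReal (f (γ s))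

/-- The admissible curves `(ℓ, γ)` for `f` in `A` from `x` to `y` that are transversal to `N`. -/
def admissibleCurves {X : Type*} [MetricSpace X] (A : Set X) (f : X → ℝ) (N : Set X) (x y : X) :
    Set (ℝ × (ℝ → X)) :=
  {c | IsArcLengthCurve A x y c.1 c.2 ∧ pathIntegral f c.1 c.2 < ∞ ∧ IsTransversal N c.1 c.2}

/-- The optical length `L_f^N` over admissible curves in `A` transversal to `N`
(`∞` if there are none). -/
def opticalLength {X : Type*} [MetricSpace X] (A : Set X) (f : X → ℝ) (N : Set X) (x y : X) :
    ℝ≥0∞ :=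
  ⨅ c ∈ admissibleCurves A f N x y, pathIntegral f c.1 c.2

/-- The maximal optical length: the supremum of `L_f^N` over all null sets `N ⊆ A`. -/
def maxOpticalLength {X : Type*} [MetricSpace X] [MeasurableSpace X] (μ : Measure X) (A : Set X)
    (f : X → ℝ) (x y : X) : ℝ≥0∞ :=
  ⨆ (N : Set X) (_ : N ⊆ A ∧ μ N = 0), opticalLength A f N x y

/-- The infimum over `y ∈ ∂Ω` of `L̃_f(x, y) + g(y)`, as an extended real number, where `L̃_f` is
the maximal optical length in the closure of `Ω`. -/
def extValue {X : Type*} [MetricSpace X] [MeasurableSpace X] (μ : Measure X) (Ω : Set X)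
    (f g : X → ℝ) (x : X) : EReal :=
  ⨅ y ∈ frontier Ω, ((maxOpticalLength μ (closure Ω) f x y : ℝ≥0∞) : EReal) + (g y : EReal)

/-- The real function `ũ` given by `extValue`. -/
def transversalMonge {X : Type*} [MetricSpace X] [MeasurableSpace X] (μ : Measure X) (Ω : Set X)
    (f g : X → ℝ) (x : X) : ℝ :=
  (extValue μ Ω f g x).toReal

/-- The slope `|∇u|(x) = limsup_{y → x} |u(y) - u(x)| / d(x, y)`. -/
def slope {X : Type*} [MetricSpace X] (u : X → ℝ) (x : X) : ℝ≥0∞ :=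
  limsup (fun y => edist (u y) (u x) / edist y x) (𝓝[≠] x)

/-- The class `S_weak` of weak subsolutions of `|∇u| = f` in `Ω`, `u = g` on `∂Ω`.
Only the values on the closure of `Ω` matter. -/
def weakSubsolutions {X : Type*} [MetricSpace X] [MeasurableSpace X] (μ : Measure X) (Ω : Set X)
    (f g : X → ℝ) : Set (X → ℝ) :=
  {v | LocallyLipschitzOn Ω v ∧ ContinuousOn v (closure Ω) ∧
    (∀ᵐ x ∂(μ.restrict Ω), slope v x ≤ ENNReal.ofReal (f x)) ∧
    ∀ x ∈ frontier Ω, v x ≤ g x}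

end

end Eikonal

/-!
The function `L̃_f` (`maxOpticalLength`) is a finite pseudo-distance on the closure of `Ω`;
its symmetry is not needed. The triangle inequality comes from concatenating curves, and if
`f ≤ c` off a null set near `x`, then the almost shortest transversal curves of the weak Fubini property give
`L̃_f(x, y) ≤ c d(x, y)` for `y` near `x` (`maxOpticalLength_le_of_forall_le`). With `c = ‖f‖_∞` this
makes the Monge function `ũ` finite and Lipschitz. With `c = f x + ε` it bounds the slope of `ũ` at
points where `f` is upper semicontinuous off a null set (`slope_transversalMonge_le`), so that `ũ`
is a weak subsolution.

For the comparison `v ≤ ũ`, a curve from `x` to `y ∈ ∂Ω` is stopped at its first point `y'` on the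
frontier. Along the first part, which runs in `Ω`, the function `v ∘ γ` is absolutely continuous
with derivative bounded by the slope of `v`, hence `v x - v y'` is at most the integral of `f`. For
the second part one uses `v y' ≤ g y' ≤ L̃_f(y', y) + g y`. Since `y'` depends on the curve, a single
null set has to realize the supremum in `L̃_f` for all pairs of points simultaneously
(`exists_null_forall_maxOpticalLength_le`). It exists because optical lengths are Lipschitz and
bounded sets are separable, and separability is what the doubling property provides
(`IsDoubling.exists_countable_dense_subset`).
-/

namespace Eikonal


/-! ### Concatenation, transversality and path integrals -/

section Curves

variable {X : Type*} {N : Set X} {f : X → ℝ} {ℓ ℓ₁ ℓ₂ : ℝ} {γ γ₁ γ₂ : ℝ → X}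

/-- Concatenation of the curve `γ₁ : [0, ℓ] → X` with `γ₂`. -/
noncomputable def appendCurve (ℓ : ℝ) (γ₁ γ₂ : ℝ → X) (t : ℝ) : X :=
  if t ≤ ℓ then γ₁ t else γ₂ (t - ℓ)

lemma appendCurve_left {t : ℝ} (ht : t ≤ ℓ) : appendCurve ℓ γ₁ γ₂ t = γ₁ t := if_pos ht

lemma appendCurve_right (h : γ₁ ℓ = γ₂ 0) {t : ℝ} (ht : ℓ ≤ t) :
    appendCurve ℓ γ₁ γ₂ t = γ₂ (t - ℓ) := by
  rcases ht.eq_or_lt with rfl | ht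
  · simp [appendCurve, h]
  · exact if_neg ht.not_ge

lemma isTransversal_iff : IsTransversal N ℓ γ ↔ volume (Icc 0 ℓ ∩ γ ⁻¹' N) = 0 := by
  rw [IsTransversal, hausdorffMeasure_real]

lemma isTransversal_iff_ae :
    IsTransversal N ℓ γ ↔ ∀ᵐ s ∂volume.restrict (Icc 0 ℓ), γ s ∉ N := by
  rw [isTransversal_iff, ae_restrict_iff' measurableSet_Icc, ae_iff]
  congr! 2
  ext s
  simp [and_assoc]

lemma IsTransversal.mono {N' : Set X} (h : IsTransversal N' ℓ γ) (hN : N ⊆ N') :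
    IsTransversal N ℓ γ :=
  measure_mono_null (inter_subset_inter_right _ (preimage_mono hN)) h

lemma IsTransversal.suffix (h : IsTransversal N ℓ γ) {t : ℝ} (ht : 0 ≤ t) :
    IsTransversal N (ℓ - t) (fun s => γ (s + t)) := by
  rw [isTransversal_iff] at h ⊢
  rw [← measure_preimage_add_right volume t] at h
  refine measure_mono_null (fun s hs => ?_) h
  exact ⟨⟨by linarith [hs.1.1], by linarith [hs.1.2]⟩, hs.2⟩

lemma IsTransversal.append (h₁ : IsTransversal N ℓ₁ γ₁) (h₂ : IsTransversal N ℓ₂ γ₂) :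
    IsTransversal N (ℓ₁ + ℓ₂) (appendCurve ℓ₁ γ₁ γ₂) := by
  rw [isTransversal_iff] at h₁ h₂ ⊢
  rw [← measure_preimage_add_right volume (-ℓ₁)] at h₂
  refine measure_mono_null (fun s hs => ?_) (measure_union_null h₁ h₂)
  obtain ⟨⟨h0, h1⟩, hN⟩ := hs
  rw [mem_preimage] at hN
  rcases le_or_gt s ℓ₁ with h | h
  · rw [appendCurve_left h] at hN
    exact Or.inl ⟨⟨h0, h⟩, hN⟩
  · rw [appendCurve, if_neg h.not_ge] at hN
    exact Or.inr ⟨⟨by linarith, by linarith⟩, by simpa [sub_eq_add_neg] using hN⟩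

/-- Translation invariance; no measurability of the integrand is needed. -/
lemma setLIntegral_Icc_comp_add (F : ℝ → ℝ≥0∞) (a b c : ℝ) :
    ∫⁻ s in Icc (a - c) (b - c), F (s + c) = ∫⁻ s in Icc a b, F s := by
  have h := (measurePreserving_add_right (volume : Measure ℝ) c).setLIntegral_comp_preimage_emb
    (measurableEmbedding_addRight c) F (Icc a b)
  rwa [preimage_add_const_Icc] at h

lemma pathIntegral_append_le :
    pathIntegral f (ℓ₁ + ℓ₂) (appendCurve ℓ₁ γ₁ γ₂)
      ≤ pathIntegral f ℓ₁ γ₁ + pathIntegral f ℓ₂ γ₂ := by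
  have hsub : Icc 0 (ℓ₁ + ℓ₂) ⊆ Icc 0 ℓ₁ ∪ Ioc ℓ₁ (ℓ₁ + ℓ₂) := fun s hs =>
    (le_or_gt s ℓ₁).imp (fun h => ⟨hs.1, h⟩) (fun h => ⟨h, hs.2⟩)
  refine (lintegral_mono_set hsub).trans ((lintegral_union_le _ _ _).trans (add_le_add ?_ ?_))
  · exact (setLIntegral_congr_fun measurableSet_Icc
      fun s hs => by simp only [appendCurve_left hs.2]).le
  · have h := setLIntegral_Icc_comp_add (fun s => ENNReal.ofReal (f (γ₂ s))) 0 ℓ₂ (-ℓ₁)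
    rw [show (0 : ℝ) - -ℓ₁ = ℓ₁ by ring, show ℓ₂ - -ℓ₁ = ℓ₁ + ℓ₂ by ring] at h
    refine le_trans (le_of_eq ?_) ((lintegral_mono_set Ioc_subset_Icc_self).trans h.le)
    refine setLIntegral_congr_fun measurableSet_Ioc fun s hs => ?_
    simp only [appendCurve, if_neg hs.1.not_ge, sub_eq_add_neg]

lemma pathIntegral_split {t : ℝ} (ht : t ∈ Icc 0 ℓ) :
    pathIntegral f ℓ γ = (∫⁻ s in Ico 0 t, ENNReal.ofReal (f (γ s)))
      + pathIntegral f (ℓ - t) (fun s => γ (s + t)) := by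
  have h := setLIntegral_Icc_comp_add (fun s => ENNReal.ofReal (f (γ s))) t ℓ t
  rw [sub_self] at h
  rw [pathIntegral, pathIntegral, h, ← lintegral_union measurableSet_Icc,
    Ico_union_Icc_eq_Icc ht.1 ht.2]
  exact disjoint_left.2 fun s hs hs' => hs.2.not_ge hs'.1

end Curves

/-! ### Curves parametrized by arc length -/

section ArcLength

variable {X : Type*} [MetricSpace X] {A : Set X} {x y z : X} {ℓ ℓ₁ ℓ₂ : ℝ} {γ γ₁ γ₂ : ℝ → X}

lemma hasUnitSpeedOn_comp_add {a b : ℝ} (h : HasUnitSpeedOn γ (Icc a b)) (c : ℝ) :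
    HasUnitSpeedOn (fun t => γ (t + c)) (Icc (a - c) (b - c)) := by
  intro s hs t ht
  have himg : (fun t => t + c) '' Icc (a - c) (b - c) = Icc a b := by simp
  have h1 := eVariationOn.comp_inter_Icc_eq_of_monotoneOn γ (t := Icc (a - c) (b - c))
    (fun t => t + c) (fun p _ q _ hpq => by simpa using hpq) hs ht
  rw [himg] at h1
  have h2 := h (x := s + c) ⟨by linarith [hs.1], by linarith [hs.2]⟩ (y := t + c)
    ⟨by linarith [ht.1], by linarith [ht.2]⟩
  rw [show t + c - (s + c) = t - s by ring] at h2
  exact h1.trans h2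

lemma IsArcLengthCurve.lipschitzOnWith (h : IsArcLengthCurve A x y ℓ γ) :
    LipschitzOnWith 1 γ (Icc 0 ℓ) := by
  have key : ∀ s ∈ Icc (0 : ℝ) ℓ, ∀ t ∈ Icc (0 : ℝ) ℓ, s ≤ t →
      edist (γ s) (γ t) ≤ edist s t := by
    intro s hs t ht hst
    have h1 := h.unitSpeed hs ht
    have h2 : edist (γ s) (γ t) ≤ eVariationOn γ (Icc 0 ℓ ∩ Icc s t) :=
      eVariationOn.edist_le γ ⟨hs, le_rfl, hst⟩ ⟨ht, hst, le_rfl⟩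
    rw [h1] at h2
    rw [edist_comm s t, edist_dist t s, Real.dist_eq, abs_of_nonneg (sub_nonneg.2 hst)]
    simpa using h2
  intro s hs t ht
  rw [ENNReal.coe_one, one_mul]
  rcases le_total s t with hst | hst
  · exact key s hs t ht hst
  · rw [edist_comm (γ s), edist_comm s]
    exact key t ht s hs hst

lemma IsArcLengthCurve.dist_le (h : IsArcLengthCurve A x y ℓ γ) {s : ℝ} (hs : s ∈ Icc 0 ℓ) :
    dist x (γ s) ≤ ℓ := by
  have h1 := h.lipschitzOnWith.dist_le_mul 0 ⟨le_rfl, h.nonneg⟩ s hs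
  rw [h.source, Real.dist_eq, zero_sub, abs_neg, abs_of_nonneg hs.1] at h1
  simp only [NNReal.coe_one, one_mul] at h1
  exact h1.trans hs.2

lemma isArcLengthCurve_const (hx : x ∈ A) : IsArcLengthCurve A x x 0 (fun _ => x) where
  nonneg := le_rfl
  mapsTo := fun _ _ => hx
  unitSpeed := hasConstantSpeedOnWith_of_subsingleton _ (by simp) _
  source := rfl
  target := rfl

lemma IsArcLengthCurve.suffix (h : IsArcLengthCurve A x y ℓ γ) {t : ℝ} (ht : t ∈ Icc 0 ℓ) :
    IsArcLengthCurve A (γ t) y (ℓ - t) (fun s => γ (s + t)) where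
  nonneg := sub_nonneg.2 ht.2
  mapsTo := fun s hs => h.mapsTo ⟨by linarith [hs.1, ht.1], by linarith [hs.2]⟩
  unitSpeed := by
    have h1 : HasUnitSpeedOn γ (Icc t ℓ) := by
      intro p hp q hq
      have hp' : p ∈ Icc 0 ℓ := ⟨ht.1.trans hp.1, hp.2⟩
      have hq' : q ∈ Icc 0 ℓ := ⟨ht.1.trans hq.1, hq.2⟩
      rw [← h.unitSpeed hp' hq', inter_eq_right.2 (Icc_subset_Icc hp.1 hq.2),
        inter_eq_right.2 (Icc_subset_Icc hp'.1 hq'.2)]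
    simpa using hasUnitSpeedOn_comp_add h1 t
  source := by simp
  target := by simp [h.target]

lemma hasUnitSpeedOn_congr {s : Set ℝ} (h : HasUnitSpeedOn γ₁ s) (hs : EqOn γ₂ γ₁ s) :
    HasUnitSpeedOn γ₂ s := by
  intro p hp q hq
  rw [← h hp hq]
  exact eVariationOn.congr (hs.mono inter_subset_left)

lemma IsArcLengthCurve.append (h₁ : IsArcLengthCurve A x y ℓ₁ γ₁)
    (h₂ : IsArcLengthCurve A y z ℓ₂ γ₂) :
    IsArcLengthCurve A x z (ℓ₁ + ℓ₂) (appendCurve ℓ₁ γ₁ γ₂) := by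
  have hj : γ₁ ℓ₁ = γ₂ 0 := h₁.target.trans h₂.source.symm
  have hn₁ := h₁.nonneg
  have hn₂ := h₂.nonneg
  refine ⟨add_nonneg hn₁ hn₂, fun t ht => ?_, ?_, ?_, ?_⟩
  · rcases le_total t ℓ₁ with h | h
    · rw [appendCurve_left h]
      exact h₁.mapsTo ⟨ht.1, h⟩
    · rw [appendCurve_right hj h]
      exact h₂.mapsTo ⟨sub_nonneg.2 h, by linarith [ht.2]⟩
  · refine HasUnitSpeedOn.Icc_Icc (y := ℓ₁) (hasUnitSpeedOn_congr h₁.unitSpeed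
      fun t ht => appendCurve_left ht.2) ?_
    have h := hasUnitSpeedOn_comp_add h₂.unitSpeed (-ℓ₁)
    rw [show (0 : ℝ) - -ℓ₁ = ℓ₁ by ring, show ℓ₂ - -ℓ₁ = ℓ₁ + ℓ₂ by ring] at h
    exact hasUnitSpeedOn_congr h fun t ht => appendCurve_right hj ht.1
  · rw [appendCurve_left hn₁, h₁.source]
  · rw [appendCurve_right hj (by linarith), add_sub_cancel_left, h₂.target]

end ArcLength

/-! ### Optical lengths -/

section OpticalLength

variable {X : Type*} [MetricSpace X] {A N N' : Set X} {f : X → ℝ} {x y z : X}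

lemma opticalLength_mono (h : N ⊆ N') : opticalLength A f N x y ≤ opticalLength A f N' x y :=
  biInf_mono fun _ hc => ⟨hc.1, hc.2.1, hc.2.2.mono h⟩

lemma opticalLength_le_pathIntegral {ℓ : ℝ} {γ : ℝ → X} (h : IsArcLengthCurve A x y ℓ γ)
    (ht : IsTransversal N ℓ γ) : opticalLength A f N x y ≤ pathIntegral f ℓ γ := by
  by_cases hfin : pathIntegral f ℓ γ < ∞
  · exact iInf₂_le (ℓ, γ) ⟨h, hfin, ht⟩
  · exact (not_lt_top_iff.1 hfin).symm ▸ le_top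

lemma opticalLength_triangle (A : Set X) (f : X → ℝ) (N : Set X) (x y z : X) :
    opticalLength A f N x z ≤ opticalLength A f N x y + opticalLength A f N y z := by
  simp only [opticalLength, ENNReal.iInf_add, ENNReal.add_iInf, le_iInf_iff]
  rintro ⟨ℓ₂, γ₂⟩ h₂ ⟨ℓ₁, γ₁⟩ h₁
  exact (opticalLength_le_pathIntegral (h₁.1.append h₂.1) (h₁.2.2.append h₂.2.2)).trans
    pathIntegral_append_le

lemma opticalLength_self (hx : x ∈ A) : opticalLength A f N x x = 0 := by
  refine le_antisymm ((opticalLength_le_pathIntegral (isArcLengthCurve_const hx) ?_).trans ?_)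
    zero_le
  · rw [isTransversal_iff]
    exact measure_mono_null inter_subset_left (by simp)
  · simp [pathIntegral]

variable [MeasurableSpace X] {μ : Measure X}

/-- A bound for `f` off a null set near `x` controls the optical length from `x` to nearby points:
the curves of the `∞`-weak Fubini property are almost shortest, so they stay near `x`. -/
lemma opticalLength_le_of_forall_le (hfub : InftyWeakFubini μ A) (hN : N ⊆ A) (hN0 : μ N = 0)
    (hx : x ∈ A) (hy : y ∈ A) {r c : ℝ} (hr : dist x y < r) (hc : 0 ≤ c)
    (hf : ∀ z ∈ A \ N, dist x z < r → f z ≤ c) :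
    opticalLength A f N x y ≤ ENNReal.ofReal (c * dist x y) := by
  rcases eq_or_ne x y with rfl | hxy
  · simp [opticalLength_self hx]
  have key : ∀ᶠ ε in 𝓝[>] (0 : ℝ),
      opticalLength A f N x y ≤ ENNReal.ofReal (c * (dist x y + ε)) := by
    filter_upwards [Ioo_mem_nhdsGT (sub_pos.2 hr)] with ε hε
    obtain ⟨ℓ, γ, hγ, hγN, hℓ⟩ := hfub N hN hN0 ε hε.1 x hx y hy hxy
    refine (opticalLength_le_pathIntegral hγ hγN).trans ?_
    have hbound : ∀ᵐ s ∂volume.restrict (Icc 0 ℓ),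
        ENNReal.ofReal (f (γ s)) ≤ ENNReal.ofReal c := by
      filter_upwards [isTransversal_iff_ae.1 hγN, ae_restrict_mem measurableSet_Icc] with s hs hs'
      refine ENNReal.ofReal_le_ofReal (hf _ ⟨hγ.mapsTo hs', hs⟩ ?_)
      linarith [hγ.dist_le hs', hε.2]
    calc pathIntegral f ℓ γ ≤ ∫⁻ _ in Icc 0 ℓ, ENNReal.ofReal c := lintegral_mono_ae hbound
      _ = ENNReal.ofReal (c * ℓ) := by
        rw [setLIntegral_const, Real.volume_Icc, sub_zero, ENNReal.ofReal_mul hc]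
      _ ≤ _ := ENNReal.ofReal_le_ofReal (mul_le_mul_of_nonneg_left hℓ hc)
  have hlim : Tendsto (fun ε : ℝ => ENNReal.ofReal (c * (dist x y + ε))) (𝓝[>] 0)
      (𝓝 (ENNReal.ofReal (c * dist x y))) := by
    have h : Continuous fun ε : ℝ => ENNReal.ofReal (c * (dist x y + ε)) :=
      ENNReal.continuous_ofReal.comp (by fun_prop)
    simpa using (h.tendsto 0).mono_left nhdsWithin_le_nhds
  exact ge_of_tendsto hlim key

lemma opticalLength_le_maxOpticalLength (hN : N ⊆ A) (hN0 : μ N = 0) :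
    opticalLength A f N x y ≤ maxOpticalLength μ A f x y :=
  le_iSup₂_of_le N ⟨hN, hN0⟩ le_rfl

lemma maxOpticalLength_self (hx : x ∈ A) : maxOpticalLength μ A f x x = 0 := by
  simp [maxOpticalLength, opticalLength_self hx]

lemma maxOpticalLength_triangle (μ : Measure X) (A : Set X) (f : X → ℝ) (x y z : X) :
    maxOpticalLength μ A f x z ≤ maxOpticalLength μ A f x y + maxOpticalLength μ A f y z :=
  iSup₂_le fun N hN => (opticalLength_triangle A f N x y z).trans
    (add_le_add (opticalLength_le_maxOpticalLength hN.1 hN.2)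
      (opticalLength_le_maxOpticalLength hN.1 hN.2))

lemma maxOpticalLength_le_of_forall_le (hfub : InftyWeakFubini μ A) (hN : N ⊆ A) (hN0 : μ N = 0)
    (hx : x ∈ A) (hy : y ∈ A) {r c : ℝ} (hr : dist x y < r) (hc : 0 ≤ c)
    (hf : ∀ z ∈ A \ N, dist x z < r → f z ≤ c) :
    maxOpticalLength μ A f x y ≤ ENNReal.ofReal (c * dist x y) :=
  iSup₂_le fun _ hN' => (opticalLength_mono subset_union_right).trans
    (opticalLength_le_of_forall_le hfub (union_subset hN hN'.1) (measure_union_null hN0 hN'.2)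
      hx hy hr hc fun z hz => hf z ⟨hz.1, fun h => hz.2 (Or.inl h)⟩)

lemma exists_null_opticalLength_eq (μ : Measure X) (A : Set X) (f : X → ℝ) (x y : X) :
    ∃ N ⊆ A, μ N = 0 ∧ opticalLength A f N x y = maxOpticalLength μ A f x y := by
  obtain ⟨u, -, hu, hmem⟩ := exists_seq_tendsto_sSup
    (S := {a | ∃ N ⊆ A, μ N = 0 ∧ opticalLength A f N x y = a})
    ⟨_, ∅, empty_subset _, measure_empty, rfl⟩ (OrderTop.bddAbove _)
  choose N hN hN0 hNu using hmem
  have hU : ⋃ n, N n ⊆ A := iUnion_subset hN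
  have hU0 : μ (⋃ n, N n) = 0 := measure_iUnion_null hN0
  refine ⟨⋃ n, N n, hU, hU0, le_antisymm (opticalLength_le_maxOpticalLength hU hU0) ?_⟩
  have hsup : maxOpticalLength μ A f x y
      ≤ sSup {a | ∃ N ⊆ A, μ N = 0 ∧ opticalLength A f N x y = a} :=
    iSup₂_le fun N' hN' => le_sSup ⟨N', hN'.1, hN'.2, rfl⟩
  refine hsup.trans (le_of_tendsto' hu fun n => ?_)
  rw [← hNu n]
  exact opticalLength_mono (subset_iUnion N n)

/-- On a separable set, one null set realizes the maximal optical length of all pairs of points at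
once. It collects the optimal null sets of the pairs from a countable dense set; the other pairs
follow because optical lengths are Lipschitz as soon as the null set contains `{f > M}`. -/
lemma exists_null_forall_maxOpticalLength_le {M : ℝ} (hfub : InftyWeakFubini μ A) (hM : 0 ≤ M)
    (hfM : μ {z ∈ A | M < f z} = 0) {D : Set X} (hDA : D ⊆ A) (hDc : D.Countable)
    (hD : A ⊆ closure D) :
    ∃ N ⊆ A, μ N = 0 ∧ ∀ x ∈ A, ∀ y ∈ A,
      maxOpticalLength μ A f x y ≤ opticalLength A f N x y := by
  choose N hNA hN0 hN using fun p : X × X => exists_null_opticalLength_eq μ A f p.1 p.2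
  set P : Set X := {z ∈ A | M < f z} ∪ ⋃ p ∈ D ×ˢ D, N p with hP
  have hPA : P ⊆ A := union_subset (sep_subset _ _) (iUnion₂_subset fun p _ => hNA p)
  have hP0 : μ P = 0 := measure_union_null hfM
    ((measure_biUnion_null_iff (hDc.prod hDc)).2 fun p _ => hN0 p)
  have hbd : ∀ z ∈ A \ P, f z ≤ M := fun z hz => not_lt.1 fun h => hz.2 (Or.inl ⟨hz.1, h⟩)
  have hL : ∀ p ∈ A, ∀ q ∈ A, maxOpticalLength μ A f p q ≤ ENNReal.ofReal (M * dist p q) :=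
    fun p hp q hq => maxOpticalLength_le_of_forall_le hfub hPA hP0 hp hq (lt_add_one _) hM
      fun z hz _ => hbd z hz
  have hLP : ∀ p q, opticalLength A f P p q ≤ maxOpticalLength μ A f p q :=
    fun p q => opticalLength_le_maxOpticalLength hPA hP0
  have hDD : ∀ p ∈ D, ∀ q ∈ D, maxOpticalLength μ A f p q ≤ opticalLength A f P p q := by
    intro p hp q hq
    rw [← hN (p, q)]
    exact opticalLength_mono ((subset_biUnion_of_mem (u := N) (mk_mem_prod hp hq)).trans
      subset_union_right)
  refine ⟨P, hPA, hP0, fun x hx y hy => ?_⟩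
  have key : ∀ᶠ ε in 𝓝[>] (0 : ℝ), maxOpticalLength μ A f x y
      ≤ opticalLength A f P x y + 4 * ENNReal.ofReal (M * ε) := by
    filter_upwards [self_mem_nhdsWithin] with ε hε
    obtain ⟨p, hp, hxp⟩ := Metric.mem_closure_iff.1 (hD hx) ε hε
    obtain ⟨q, hq, hyq⟩ := Metric.mem_closure_iff.1 (hD hy) ε hε
    have hpA := hDA hp
    have hqA := hDA hq
    have hle : ∀ a ∈ A, ∀ b ∈ A, dist a b < ε →
        maxOpticalLength μ A f a b ≤ ENNReal.ofReal (M * ε) := fun a ha b hb hab =>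
      (hL a ha b hb).trans (ENNReal.ofReal_le_ofReal (mul_le_mul_of_nonneg_left hab.le hM))
    have h₁ := hle x hx p hpA hxp
    have h₂ := hle p hpA x hx (dist_comm x p ▸ hxp)
    have h₃ := hle y hy q hqA hyq
    have h₄ := hle q hqA y hy (dist_comm y q ▸ hyq)
    have h₅ := maxOpticalLength_triangle μ A f x p y
    have h₆ := maxOpticalLength_triangle μ A f p q y
    have h₇ := opticalLength_triangle A f P p x q
    have h₈ := opticalLength_triangle A f P x y q
    calc maxOpticalLength μ A f x y
        ≤ maxOpticalLength μ A f x p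
          + (maxOpticalLength μ A f p q + maxOpticalLength μ A f q y) := by grw [h₅, h₆]
      _ ≤ ENNReal.ofReal (M * ε) + ((ENNReal.ofReal (M * ε)
          + (opticalLength A f P x y + ENNReal.ofReal (M * ε))) + ENNReal.ofReal (M * ε)) := by
        grw [hDD p hp q hq, h₇, h₈, hLP p x, hLP y q, h₁, h₂, h₃, h₄]
      _ = _ := by ring
  have hlim : Tendsto (fun ε : ℝ => opticalLength A f P x y + 4 * ENNReal.ofReal (M * ε))
      (𝓝[>] 0) (𝓝 (opticalLength A f P x y)) := by
    have h : Continuous fun ε : ℝ => opticalLength A f P x y + 4 * ENNReal.ofReal (M * ε) :=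
      continuous_const.add ((ENNReal.continuous_const_mul (by simp)).comp
        (ENNReal.continuous_ofReal.comp (by fun_prop)))
    simpa using (h.tendsto 0).mono_left nhdsWithin_le_nhds
  exact ge_of_tendsto hlim key

end OpticalLength

/-! ### Doubling measures and separability -/

section Doubling

variable {X : Type*} [MetricSpace X] [MeasurableSpace X] {μ : Measure X}

lemma IsDoubling.exists_measure_ball_le (h : IsDoubling μ) :
    ∃ C : ℝ≥0, ∀ (x : X) (r : ℝ), 0 < r → ∀ k : ℕ,
      μ (Metric.ball x (2 ^ k * r)) ≤ C ^ k * μ (Metric.ball x r) := by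
  obtain ⟨C, -, hC⟩ := h
  refine ⟨C, fun x r hr k => ?_⟩
  induction k with
  | zero => simp
  | succ k ih =>
    calc μ (Metric.ball x (2 ^ (k + 1) * r)) = μ (Metric.ball x (2 * (2 ^ k * r))) := by
          rw [pow_succ']; ring_nf
      _ ≤ C * μ (Metric.ball x (2 ^ k * r)) := hC x _ (by positivity)
      _ ≤ C * (C ^ k * μ (Metric.ball x r)) := by gcongr
      _ = C ^ (k + 1) * μ (Metric.ball x r) := by rw [pow_succ']; ring

lemma exists_lt_two_pow_mul {r : ℝ} (hr : 0 < r) (R : ℝ) : ∃ k : ℕ, R < 2 ^ k * r := by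
  obtain ⟨k, hk⟩ := pow_unbounded_of_one_lt (R / r) one_lt_two
  exact ⟨k, (div_lt_iff₀ hr).1 hk⟩

lemma IsDoubling.measure_ball_pos (h : IsDoubling μ) (h0 : μ ≠ 0) (x : X) {r : ℝ} (hr : 0 < r) :
    0 < μ (Metric.ball x r) := by
  obtain ⟨C, hC⟩ := h.exists_measure_ball_le
  refine pos_iff_ne_zero.2 fun hz => h0 (Measure.measure_univ_eq_zero.1 ?_)
  have huniv : (⋃ k : ℕ, Metric.ball x (2 ^ k * r)) = univ :=
    eq_univ_of_forall fun y => mem_iUnion.2 (exists_lt_two_pow_mul hr (dist y x))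
  rw [← huniv]
  exact measure_iUnion_null fun k => le_antisymm (by simpa [hz] using hC x r hr k) zero_le

lemma IsDoubling.measure_ball_lt_top [IsLocallyFiniteMeasure μ] (h : IsDoubling μ) (x : X)
    (R : ℝ) : μ (Metric.ball x R) < ∞ := by
  obtain ⟨C, hC⟩ := h.exists_measure_ball_le
  obtain ⟨s, hs, hsμ⟩ := μ.finiteAt_nhds x
  obtain ⟨r, hr, hrs⟩ := Metric.mem_nhds_iff.1 hs
  obtain ⟨k, hk⟩ := exists_lt_two_pow_mul hr R
  calc μ (Metric.ball x R) ≤ μ (Metric.ball x (2 ^ k * r)) :=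
        measure_mono (Metric.ball_subset_ball hk.le)
    _ ≤ C ^ k * μ (Metric.ball x r) := hC x r hr k
    _ < ∞ := ENNReal.mul_lt_top (by simp) ((measure_mono hrs).trans_lt hsμ)

/-- Disjoint balls of a fixed radius centred in a bounded set have positive measure and lie in a
ball of finite measure, so there are only countably many; by the Vitali covering lemma such a family
can be chosen so that its centres are an arbitrarily fine net. -/
lemma IsDoubling.exists_countable_dense_subset [OpensMeasurableSpace X] [IsLocallyFiniteMeasure μ]
    (h : IsDoubling μ) (h0 : μ ≠ 0) {A : Set X} (hA : Bornology.IsBounded A) :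
    ∃ D ⊆ A, D.Countable ∧ A ⊆ closure D := by
  refine EMetric.subset_countable_closure_of_almost_dense_set A fun ε hε => ?_
  obtain ⟨δ, hδ, hδε⟩ : ∃ δ : ℝ, 0 < δ ∧ ENNReal.ofReal (4 * δ) ≤ ε := by
    obtain ⟨e, he, heε⟩ := ENNReal.lt_iff_exists_nnreal_btwn.1 hε
    have he' : (0 : ℝ) < e := by exact_mod_cast he
    refine ⟨e / 4, by positivity, ?_⟩
    rw [mul_div_cancel₀ _ (by norm_num), ENNReal.ofReal_coe_nnreal]
    exact heε.le
  obtain ⟨u, huA, hdisj, hcov⟩ := Vitali.exists_disjoint_subfamily_covering_enlargement_closedBall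
    A (id : X → X) (fun _ => δ) δ (fun _ _ => le_rfl) 4 (by norm_num)
  refine ⟨u, ?_, fun a ha => ?_⟩
  · rcases A.eq_empty_or_nonempty with rfl | ⟨a, -⟩
    · exact (subset_empty_iff.1 huA).symm ▸ countable_empty
    obtain ⟨R, hR⟩ := hA.subset_ball a
    have hcount := Measure.countable_meas_pos_of_disjoint_of_meas_iUnion_ne_top (ι := u) μ
      (As := fun b => Metric.ball (b : X) δ) (fun _ => Metric.isOpen_ball.measurableSet)
      (fun b c hbc => (hdisj b.2 c.2 (Subtype.coe_injective.ne hbc)).mono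
        Metric.ball_subset_closedBall Metric.ball_subset_closedBall)
      (ne_top_of_le_ne_top (h.measure_ball_lt_top a (R + δ)).ne (measure_mono ?_))
    · have huniv : {b : u | 0 < μ (Metric.ball (b : X) δ)} = univ :=
        eq_univ_of_forall fun b => h.measure_ball_pos h0 _ hδ
      rw [huniv, countable_univ_iff] at hcount
      exact hcount
    · refine iUnion_subset fun b => Metric.ball_subset_ball' ?_
      have := Metric.mem_ball.1 (hR (huA b.2))
      linarith
  · obtain ⟨b, hb, hab⟩ := hcov a ha
    refine mem_iUnion₂.2 ⟨b, hb, ?_⟩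
    have h1 := hab (Metric.mem_closedBall_self hδ.le)
    rw [Metric.mem_closedEBall, edist_dist]
    exact (ENNReal.ofReal_le_ofReal (Metric.mem_closedBall.1 h1)).trans hδε

end Doubling

/-! ### Geodesic spaces and null measures -/

section Geodesic

variable {X : Type*} [MetricSpace X]

lemma IsGeodesicSpace.preconnectedSpace (h : IsGeodesicSpace X) : PreconnectedSpace X := by
  refine ⟨isPreconnected_of_forall_pair fun x _ y _ => ?_⟩
  obtain ⟨γ, h0, h1, hγ⟩ := h x y
  have hcont : ContinuousOn γ (Icc 0 (dist x y)) := by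
    refine (LipschitzOnWith.of_dist_le_mul (K := 1) fun s hs t ht => ?_).continuousOn
    rw [hγ s hs t ht, Real.dist_eq, NNReal.coe_one, one_mul]
  exact ⟨γ '' Icc 0 (dist x y), subset_univ _, ⟨0, ⟨le_rfl, dist_nonneg⟩, h0⟩,
    ⟨dist x y, ⟨dist_nonneg, le_rfl⟩, h1⟩, isPreconnected_Icc.image γ hcont⟩

/-- The `∞`-weak Fubini property fails for the zero measure: no nonconstant curve in `A` is
transversal to `A`. -/
lemma InftyWeakFubini.measure_ne_zero [MeasurableSpace X] {μ : Measure X} {A : Set X}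
    (h : InftyWeakFubini μ A) {x y : X} (hx : x ∈ A) (hy : y ∈ A) (hxy : x ≠ y) : μ ≠ 0 := by
  rintro rfl
  obtain ⟨ℓ, γ, hγ, hγA, -⟩ := h A Subset.rfl rfl 1 one_pos x hx y hy hxy
  rw [isTransversal_iff, inter_eq_left.2 (show Icc 0 ℓ ⊆ γ ⁻¹' A from hγ.mapsTo),
    Real.volume_Icc, sub_zero, ENNReal.ofReal_eq_zero] at hγA
  have h0 : ℓ = 0 := le_antisymm hγA hγ.nonneg
  exact hxy (by rw [← hγ.source, ← hγ.target, h0])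

end Geodesic

/-! ### Slopes along curves -/

section Slope

variable {X : Type*} [MetricSpace X] {v : X → ℝ} {x : X}

lemma eventually_edist_le_of_slope_lt {c : ℝ≥0} (h : slope v x < c) :
    ∀ᶠ y in 𝓝 x, edist (v y) (v x) ≤ c * edist y x := by
  have h1 := eventually_lt_of_limsup_lt h
  rw [eventually_nhdsWithin_iff] at h1
  filter_upwards [h1] with y hy
  rcases eq_or_ne y x with rfl | hyx
  · simp
  · exact (ENNReal.div_le_iff (edist_pos.2 hyx).ne' (edist_ne_top _ _)).1 (hy hyx).le

lemma slope_le_of_eventually_edist_le {c : ℝ≥0∞}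
    (h : ∀ᶠ y in 𝓝 x, edist (v y) (v x) ≤ c * edist y x) : slope v x ≤ c := by
  refine limsup_le_of_le (by isBoundedDefault) ?_
  filter_upwards [nhdsWithin_le_nhds h, self_mem_nhdsWithin] with y hy hyx
  exact (ENNReal.div_le_iff (edist_pos.2 hyx).ne' (edist_ne_top _ _)).2 hy

/-- No differentiability is required: where the derivative does not exist, it is zero. -/
lemma enorm_deriv_comp_le_slope {γ : ℝ → X} {s : Set ℝ} (hγ : LipschitzOnWith 1 γ s) {t : ℝ}
    (hs : s ∈ 𝓝 t) : ‖deriv (v ∘ γ) t‖ₑ ≤ slope v (γ t) := by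
  refine ENNReal.le_of_forall_nnreal_lt fun c hc => ?_
  by_contra! hlt
  obtain ⟨c', h1, h2⟩ := ENNReal.lt_iff_exists_nnreal_btwn.1 hlt
  have hcont : ContinuousAt γ t := hγ.continuousOn.continuousAt hs
  have hev : ∀ᶠ p in 𝓝 t, ‖(v ∘ γ) p - (v ∘ γ) t‖ ≤ c' * ‖p - t‖ := by
    filter_upwards [hcont.eventually (eventually_edist_le_of_slope_lt h1), hs] with p hp hps
    have h3 : edist (v (γ p)) (v (γ t)) ≤ c' * edist p t :=
      hp.trans (mul_le_mul_right (by simpa using hγ hps (mem_of_mem_nhds hs)) _)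
    rw [edist_nndist, edist_nndist, ← ENNReal.coe_mul, ENNReal.coe_le_coe] at h3
    rw [← dist_eq_norm, ← dist_eq_norm]
    exact_mod_cast h3
  have h4 := norm_deriv_le_of_lip' c'.2 hev
  have h5 : ‖deriv (v ∘ γ) t‖ₑ ≤ c' := by
    rw [enorm_eq_nnnorm, ENNReal.coe_le_coe]
    exact_mod_cast h4
  exact absurd (hc.trans_le h5) (by simpa using h2.le)

variable {Ω : Set X} {f : X → ℝ} {γ : ℝ → X}

lemma locallyLipschitzOn_comp {s : Set ℝ} (hv : LocallyLipschitzOn Ω v)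
    (hγ : LipschitzOnWith 1 γ s) (hm : MapsTo γ s Ω) : LocallyLipschitzOn s (v ∘ γ) := by
  intro t ht
  obtain ⟨K, U, hU, hK⟩ := hv (hm ht)
  refine ⟨K * 1, s ∩ γ ⁻¹' U, inter_mem self_mem_nhdsWithin ?_,
    hK.comp (hγ.mono inter_subset_left) fun _ hp => hp.2⟩
  exact (hγ.continuousOn t ht).tendsto_nhdsWithin hm hU

/-- Along a curve inside `Ω` the decrease of `v` is at most the integral of `f`, because `v ∘ γ` is
absolutely continuous with derivative bounded by the slope of `v`. -/
lemma ofReal_sub_le_lintegral_of_slope_le {b : ℝ} (hb : 0 ≤ b) (hv : LocallyLipschitzOn Ω v)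
    (hγ : LipschitzOnWith 1 γ (Icc 0 b)) (hm : MapsTo γ (Icc 0 b) Ω)
    (hf : ∀ᵐ s ∂volume.restrict (Ico 0 b), slope v (γ s) ≤ ENNReal.ofReal (f (γ s))) :
    ENNReal.ofReal (v (γ 0) - v (γ b)) ≤ ∫⁻ s in Ico 0 b, ENNReal.ofReal (f (γ s)) := by
  obtain ⟨K, hK⟩ := (locallyLipschitzOn_comp hv hγ hm).exists_lipschitzOnWith_of_compact
    isCompact_Icc
  rw [← uIcc_of_le hb] at hK
  have hFTC := hK.absolutelyContinuousOnInterval.integral_deriv_eq_sub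
  have h1 : v (γ 0) - v (γ b) ≤ ‖∫ s in (0 : ℝ)..b, deriv (v ∘ γ) s‖ := by
    rw [hFTC, Real.norm_eq_abs, ← neg_sub]
    exact neg_le_abs _
  calc ENNReal.ofReal (v (γ 0) - v (γ b))
      ≤ ENNReal.ofReal ‖∫ s in (0 : ℝ)..b, deriv (v ∘ γ) s‖ := ENNReal.ofReal_le_ofReal h1
    _ = ‖∫ s in Ioc 0 b, deriv (v ∘ γ) s‖ₑ := by
      rw [ofReal_norm, intervalIntegral.integral_of_le hb]
    _ ≤ ∫⁻ s in Ioc 0 b, ‖deriv (v ∘ γ) s‖ₑ := enorm_integral_le_lintegral_enorm _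
    _ = ∫⁻ s in Ioo 0 b, ‖deriv (v ∘ γ) s‖ₑ := by rw [restrict_Ioo_eq_restrict_Ioc]
    _ ≤ ∫⁻ s in Ioo 0 b, ENNReal.ofReal (f (γ s)) := by
      refine lintegral_mono_ae ?_
      filter_upwards [ae_restrict_of_ae_restrict_of_subset Ioo_subset_Ico_self hf,
        ae_restrict_mem measurableSet_Ioo] with s hs hs'
      exact (enorm_deriv_comp_le_slope hγ (Icc_mem_nhds hs'.1 hs'.2)).trans hs
    _ ≤ _ := lintegral_mono_set Ioo_subset_Ico_self

/-- A curve that starts in the closure of `Ω` and ends on the frontier has a first point on the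
frontier; up to that point it runs in `Ω`. -/
lemma exists_first_mem_frontier (hΩ : IsOpen Ω) {ℓ : ℝ} (hℓ : 0 ≤ ℓ)
    (hγ : ContinuousOn γ (Icc 0 ℓ)) (hm : MapsTo γ (Icc 0 ℓ) (closure Ω))
    (hend : γ ℓ ∈ frontier Ω) :
    ∃ t ∈ Icc 0 ℓ, γ t ∈ frontier Ω ∧ ∀ s ∈ Ico 0 t, γ s ∈ Ω := by
  have hK : IsCompact (Icc 0 ℓ ∩ γ ⁻¹' frontier Ω) :=
    isCompact_Icc.of_isClosed_subset
      (hγ.preimage_isClosed_of_isClosed isClosed_Icc isClosed_frontier) inter_subset_left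
  obtain ⟨t, ht, hmin⟩ := hK.exists_isLeast ⟨ℓ, ⟨hℓ, le_rfl⟩, hend⟩
  refine ⟨t, ht.1, ht.2, fun s hs => ?_⟩
  have hsI : s ∈ Icc 0 ℓ := ⟨hs.1, hs.2.le.trans ht.1.2⟩
  by_contra hsΩ
  refine hs.2.not_ge (hmin ⟨hsI, ?_⟩)
  rw [mem_preimage, hΩ.frontier_eq]
  exact ⟨hm hsI, hsΩ⟩

/-- The estimate of `ofReal_sub_le_lintegral_of_slope_le` up to the end of the curve, which may lie
on the frontier. -/
lemma ofReal_sub_le_lintegral_of_slope_le_of_continuousOn {t : ℝ} (ht : 0 ≤ t)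
    (hv : LocallyLipschitzOn Ω v) (hvc : ContinuousOn v (closure Ω))
    (hγ : LipschitzOnWith 1 γ (Icc 0 t)) (hmc : MapsTo γ (Icc 0 t) (closure Ω))
    (hm : ∀ s ∈ Ico 0 t, γ s ∈ Ω)
    (hf : ∀ᵐ s ∂volume.restrict (Ico 0 t), slope v (γ s) ≤ ENNReal.ofReal (f (γ s))) :
    ENNReal.ofReal (v (γ 0) - v (γ t)) ≤ ∫⁻ s in Ico 0 t, ENNReal.ofReal (f (γ s)) := by
  rcases ht.eq_or_lt with rfl | ht
  · simp
  have hcont : ContinuousOn (v ∘ γ) (Icc 0 t) := hvc.comp hγ.continuousOn hmc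
  have hlim : Tendsto (fun b => ENNReal.ofReal (v (γ 0) - v (γ b))) (𝓝[<] t)
      (𝓝 (ENNReal.ofReal (v (γ 0) - v (γ t)))) := by
    refine ENNReal.tendsto_ofReal (tendsto_const_nhds.sub ?_)
    refine (hcont t ⟨ht.le, le_rfl⟩).mono_left ?_
    rw [← nhdsWithin_Ico_eq_nhdsLT ht]
    exact nhdsWithin_mono _ Ico_subset_Icc_self
  refine le_of_tendsto hlim ?_
  filter_upwards [Ico_mem_nhdsLT ht] with b hb
  have hsub : Ico 0 b ⊆ Ico 0 t := Ico_subset_Ico_right hb.2.le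
  exact (ofReal_sub_le_lintegral_of_slope_le hb.1 hv (hγ.mono (Icc_subset_Icc_right hb.2.le))
    (fun s hs => hm s ⟨hs.1, hs.2.trans_lt hb.2⟩)
    (ae_restrict_of_ae_restrict_of_subset hsub hf)).trans (lintegral_mono_set hsub)

end Slope

/-! ### The Monge function of the maximal optical length -/

section Monge

variable {X : Type*} [MetricSpace X] [MeasurableSpace X] {μ : Measure X} {Ω : Set X} {f g : X → ℝ}
  {x y : X}

/-- The infimum defining `ũ` is finite, so its real value is not the junk value of `toReal`. -/
lemma coe_transversalMonge (hne : (frontier Ω).Nonempty)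
    (hfin : ∀ x ∈ closure Ω, ∀ y ∈ closure Ω, maxOpticalLength μ (closure Ω) f x y ≠ ∞)
    (hg : ∀ x ∈ frontier Ω, ∀ y ∈ frontier Ω,
      (g x : EReal) ≤ (maxOpticalLength μ (closure Ω) f x y : EReal) + (g y : EReal))
    (hx : x ∈ closure Ω) :
    (transversalMonge μ Ω f g x : EReal) = extValue μ Ω f g x := by
  obtain ⟨z, hz⟩ := hne
  have hcl : ∀ {w}, w ∈ frontier Ω → w ∈ closure Ω := fun hw => frontier_subset_closure hw
  refine EReal.coe_toReal (ne_top_of_le_ne_top ?_ (iInf₂_le z hz)) (ne_bot_of_le_ne_bot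
    (EReal.coe_ne_bot (g z - (maxOpticalLength μ (closure Ω) f z x).toReal))
    (le_iInf₂ fun y hy => ?_))
  · rw [← EReal.coe_ennreal_toReal (hfin x hx z (hcl hz)), ← EReal.coe_add]
    exact EReal.coe_ne_top _
  -- The triangle inequality through `x` gives the lower bound `g z - L̃_f(z, x)`, for any `z` on
  -- the frontier.
  · have h1 := hg z hz y hy
    have h2 := maxOpticalLength_triangle μ (closure Ω) f z x y
    rw [← EReal.coe_ennreal_toReal (hfin z (hcl hz) y (hcl hy)), ← EReal.coe_add,
      EReal.coe_le_coe_iff] at h1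
    rw [← EReal.coe_ennreal_toReal (hfin x hx y (hcl hy)), ← EReal.coe_add, EReal.coe_le_coe_iff]
    have h3 := ENNReal.toReal_le_add h2 (hfin z (hcl hz) x hx) (hfin x hx y (hcl hy))
    linarith

lemma le_transversalMonge_iff
    (hfin : ∀ x ∈ closure Ω, ∀ y ∈ closure Ω, maxOpticalLength μ (closure Ω) f x y ≠ ∞)
    (hT : ∀ x ∈ closure Ω, (transversalMonge μ Ω f g x : EReal) = extValue μ Ω f g x)
    (hx : x ∈ closure Ω) {c : ℝ} :
    c ≤ transversalMonge μ Ω f g x ↔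
      ∀ y ∈ frontier Ω, c ≤ (maxOpticalLength μ (closure Ω) f x y).toReal + g y := by
  rw [← EReal.coe_le_coe_iff, hT x hx, extValue, le_iInf₂_iff]
  refine forall₂_congr fun y hy => ?_
  rw [← EReal.coe_ennreal_toReal (hfin x hx y (frontier_subset_closure hy)), ← EReal.coe_add,
    EReal.coe_le_coe_iff]

lemma transversalMonge_le_add
    (hfin : ∀ x ∈ closure Ω, ∀ y ∈ closure Ω, maxOpticalLength μ (closure Ω) f x y ≠ ∞)
    (hT : ∀ x ∈ closure Ω, (transversalMonge μ Ω f g x : EReal) = extValue μ Ω f g x)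
    (hx : x ∈ closure Ω) (hy : y ∈ closure Ω) :
    transversalMonge μ Ω f g x
      ≤ transversalMonge μ Ω f g y + (maxOpticalLength μ (closure Ω) f x y).toReal := by
  rw [← sub_le_iff_le_add, le_transversalMonge_iff hfin hT hy]
  intro z hz
  have hzc := frontier_subset_closure hz
  have h1 := (le_transversalMonge_iff hfin hT hx).1 le_rfl z hz
  have h2 := ENNReal.toReal_le_add (maxOpticalLength_triangle μ (closure Ω) f x y z)
    (hfin x hx y hy) (hfin y hy z hzc)
  linarith

lemma dist_transversalMonge_le {c : ℝ} (hc : 0 ≤ c)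
    (hfin : ∀ x ∈ closure Ω, ∀ y ∈ closure Ω, maxOpticalLength μ (closure Ω) f x y ≠ ∞)
    (hT : ∀ x ∈ closure Ω, (transversalMonge μ Ω f g x : EReal) = extValue μ Ω f g x)
    (hx : x ∈ closure Ω) (hy : y ∈ closure Ω)
    (hxy : maxOpticalLength μ (closure Ω) f x y ≤ ENNReal.ofReal (c * dist x y))
    (hyx : maxOpticalLength μ (closure Ω) f y x ≤ ENNReal.ofReal (c * dist x y)) :
    dist (transversalMonge μ Ω f g x) (transversalMonge μ Ω f g y) ≤ c * dist x y := by
  have hnn : 0 ≤ c * dist x y := mul_nonneg hc dist_nonneg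
  have h1 := ENNReal.toReal_le_of_le_ofReal hnn hxy
  have h2 := ENNReal.toReal_le_of_le_ofReal hnn hyx
  have h3 := transversalMonge_le_add hfin hT hx hy
  have h4 := transversalMonge_le_add hfin hT hy hx
  rw [Real.dist_eq, abs_sub_le_iff]
  constructor <;> linarith

/-- Comparison of a weak subsolution with the boundary data along transversal curves. A curve from
`x` to `y` is stopped at its first point `y'` on the frontier: until then `v` drops by at most the
integral of `f`, and the compatibility of `g`, with a null set `N` that is optimal for all pairs
`(y', y)`, takes care of the rest. -/
lemma ofReal_sub_le_maxOpticalLength [BorelSpace X] (hΩ : IsOpen Ω) {v : X → ℝ}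
    (hv : v ∈ weakSubsolutions μ Ω f g) {N : Set X} (hNΩ : N ⊆ closure Ω) (hN0 : μ N = 0)
    (hN : ∀ x ∈ closure Ω, ∀ y ∈ closure Ω,
      maxOpticalLength μ (closure Ω) f x y ≤ opticalLength (closure Ω) f N x y)
    (hg : ∀ x ∈ frontier Ω, ∀ y ∈ frontier Ω,
      (g x : EReal) ≤ (maxOpticalLength μ (closure Ω) f x y : EReal) + (g y : EReal))
    (hy : y ∈ frontier Ω) :
    ENNReal.ofReal (v x - g y) ≤ maxOpticalLength μ (closure Ω) f x y := by
  obtain ⟨hvL, hvc, hvs, hvg⟩ := hv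
  set N' : Set X := {z ∈ Ω | ¬ slope v z ≤ ENNReal.ofReal (f z)} with hN'
  have hN'0 : μ N' = 0 := by
    rw [ae_restrict_iff' hΩ.measurableSet, ae_iff] at hvs
    refine measure_mono_null (fun z hz => ?_) hvs
    exact fun h => hz.2 (h hz.1)
  refine le_trans ?_ (opticalLength_le_maxOpticalLength (N := N ∪ N')
    (union_subset hNΩ ((sep_subset _ _).trans subset_closure)) (measure_union_null hN0 hN'0))
  refine le_iInf₂ fun c hc => ?_
  obtain ⟨ℓ, γ⟩ := c
  obtain ⟨hγ, -, htr⟩ : IsArcLengthCurve (closure Ω) x y ℓ γ ∧ pathIntegral f ℓ γ < ∞ ∧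
    IsTransversal (N ∪ N') ℓ γ := hc
  obtain ⟨t, ht, htF, htΩ⟩ := exists_first_mem_frontier hΩ hγ.nonneg hγ.lipschitzOnWith.continuousOn
    hγ.mapsTo (hγ.target.symm ▸ hy)
  have hsub : Icc 0 t ⊆ Icc 0 ℓ := Icc_subset_Icc_right ht.2
  have h1 : ENNReal.ofReal (v x - v (γ t)) ≤ ∫⁻ s in Ico 0 t, ENNReal.ofReal (f (γ s)) := by
    rw [← hγ.source]
    refine ofReal_sub_le_lintegral_of_slope_le_of_continuousOn ht.1 hvL hvc
      (hγ.lipschitzOnWith.mono hsub) (hγ.mapsTo.mono_left hsub) htΩ ?_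
    filter_upwards [ae_restrict_of_ae_restrict_of_subset (Ico_subset_Icc_self.trans hsub)
      (isTransversal_iff_ae.1 htr), ae_restrict_mem measurableSet_Ico] with s hs hs'
    by_contra h
    exact hs (Or.inr ⟨htΩ s hs', h⟩)
  have h2 : ENNReal.ofReal (g (γ t) - g y)
      ≤ pathIntegral f (ℓ - t) (fun s => γ (s + t)) := by
    have hle := (hN (γ t) (frontier_subset_closure htF) y (frontier_subset_closure hy)).trans
      (opticalLength_le_pathIntegral (hγ.suffix ht)
        ((htr.mono subset_union_left).suffix ht.1))
    refine le_trans ?_ hle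
    by_cases htop : maxOpticalLength μ (closure Ω) f (γ t) y = ∞
    · exact htop.symm ▸ le_top
    have h := hg (γ t) htF y hy
    rw [← EReal.coe_ennreal_toReal htop, ← EReal.coe_add, EReal.coe_le_coe_iff] at h
    exact ENNReal.ofReal_le_of_le_toReal (sub_le_iff_le_add.2 h)
  calc ENNReal.ofReal (v x - g y)
      ≤ ENNReal.ofReal ((v x - v (γ t)) + (g (γ t) - g y)) :=
        ENNReal.ofReal_le_ofReal (by linarith [hvg _ htF])
    _ ≤ ENNReal.ofReal (v x - v (γ t)) + ENNReal.ofReal (g (γ t) - g y) := ENNReal.ofReal_add_le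
    _ ≤ _ := add_le_add h1 h2
    _ = pathIntegral f ℓ γ := (pathIntegral_split ht).symm

/-- At a point where `f` is upper semicontinuous off a null set, almost shortest transversal curves
give `L̃_f(x, y) ≤ (f x + ε) d(x, y)` for `y` near `x`, and likewise with `x` and `y` exchanged. -/
lemma slope_transversalMonge_le (hΩ : IsOpen Ω) (hfub : InftyWeakFubini μ (closure Ω))
    (hfin : ∀ x ∈ closure Ω, ∀ y ∈ closure Ω, maxOpticalLength μ (closure Ω) f x y ≠ ∞)
    (hT : ∀ x ∈ closure Ω, (transversalMonge μ Ω f g x : EReal) = extValue μ Ω f g x)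
    {N : Set X} (hNΩ : N ⊆ Ω) (hN0 : μ N = 0) (husc : UpperSemicontinuousOn f (Ω \ N))
    (hx : x ∈ Ω \ N) (hfx : 0 ≤ f x) :
    slope (transversalMonge μ Ω f g) x ≤ ENNReal.ofReal (f x) := by
  have key : ∀ ε > 0, slope (transversalMonge μ Ω f g) x ≤ ENNReal.ofReal (f x + ε) := by
    intro ε hε
    have hc : 0 ≤ f x + ε := by linarith
    obtain ⟨r₁, hr₁, hball₁⟩ :=
      Metric.mem_nhdsWithin_iff.1 (husc x hx (f x + ε) (lt_add_of_pos_right _ hε))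
    obtain ⟨r₂, hr₂, hball₂⟩ := Metric.isOpen_iff.1 hΩ x hx.1
    set r := min r₁ r₂ with hr
    have hr0 : 0 < r := lt_min hr₁ hr₂
    have hf : ∀ z ∈ closure Ω \ N, dist x z < r → f z ≤ f x + ε := by
      intro z hz hxz
      rw [dist_comm] at hxz
      have hzΩ : z ∈ Ω := hball₂ (hxz.trans_le (min_le_right _ _))
      exact le_of_lt (hball₁ ⟨hxz.trans_le (min_le_left _ _), hzΩ, hz.2⟩)
    have hNc : N ⊆ closure Ω := hNΩ.trans subset_closure
    refine slope_le_of_eventually_edist_le ?_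
    -- Radius `r / 2`, so that the ball of that radius around `y` stays in the ball around `x` on
    -- which `f ≤ f x + ε`.
    filter_upwards [Metric.ball_mem_nhds x (half_pos hr0), hΩ.mem_nhds hx.1] with y hyx hyΩ
    rw [Metric.mem_ball] at hyx
    have hxy : dist x y < r := by rw [dist_comm]; linarith
    have h1 := maxOpticalLength_le_of_forall_le hfub hNc hN0 (subset_closure hx.1)
      (subset_closure hyΩ) hxy hc hf
    have h2 := maxOpticalLength_le_of_forall_le hfub hNc hN0 (subset_closure hyΩ)
      (subset_closure hx.1) hyx hc fun z hz hyz => hf z hz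
        (by linarith [dist_triangle x y z, dist_comm x y])
    rw [dist_comm] at h1
    rw [edist_dist, edist_dist, ← ENNReal.ofReal_mul hc]
    exact ENNReal.ofReal_le_ofReal (dist_transversalMonge_le hc hfin hT (subset_closure hyΩ)
      (subset_closure hx.1) h2 h1)
  have hlim : Tendsto (fun ε : ℝ => ENNReal.ofReal (f x + ε)) (𝓝[>] 0)
      (𝓝 (ENNReal.ofReal (f x))) := by
    have h : Continuous fun ε : ℝ => ENNReal.ofReal (f x + ε) :=
      ENNReal.continuous_ofReal.comp (by fun_prop)
    simpa using (h.tendsto 0).mono_left nhdsWithin_le_nhds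
  exact ge_of_tendsto hlim (eventually_mem_nhdsWithin.mono key)

lemma exists_null_setOf_lt [OpensMeasurableSpace X] {A : Set X} (hA : IsClosed A)
    (hf : MemLp f ∞ (μ.restrict A)) : ∃ M : ℝ, 0 ≤ M ∧ μ {z ∈ A | M < f z} = 0 := by
  have hne : eLpNorm f ∞ (μ.restrict A) ≠ ∞ := hf.2.ne
  refine ⟨(eLpNorm f ∞ (μ.restrict A)).toReal, ENNReal.toReal_nonneg, ?_⟩
  have h : ∀ᵐ z ∂μ.restrict A, ‖f z‖ₑ ≤ eLpNorm f ∞ (μ.restrict A) := ae_le_eLpNormEssSup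
  rw [ae_restrict_iff' hA.measurableSet, ae_iff] at h
  refine measure_mono_null (fun z hz => ?_) h
  refine fun hz' => ?_
  have h1 := ENNReal.toReal_mono hne (hz' hz.1)
  rw [toReal_enorm] at h1
  exact hz.2.not_ge ((le_abs_self _).trans h1)

end Monge

end Eikonal

theorem proposition6p7 {X : Type*} [MetricSpace X] [CompleteSpace X] [MeasurableSpace X]
    [BorelSpace X] (μ : Measure X) [IsLocallyFiniteMeasure μ]
    (hgeo : Eikonal.IsGeodesicSpace X) (hμ : Eikonal.IsDoubling μ)
    (Ω : Set X) (hΩo : IsOpen Ω) (hΩc : IsConnected Ω) (hΩb : Bornology.IsBounded Ω)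
    (hΩX : Ω ≠ univ) (hfub : Eikonal.InftyWeakFubini μ (closure Ω))
    (f : X → ℝ) (hfm : Measurable (fun x : closure Ω => f x)) (hfpos : ∀ x ∈ closure Ω, 0 < f x)
    (hfL : MemLp f ∞ (μ.restrict (closure Ω))) (hfα : ∃ α : ℝ, 0 < α ∧ ∀ x ∈ Ω, α ≤ f x)
    (g : X → ℝ)
    (hg : ∀ x ∈ frontier Ω, ∀ y ∈ frontier Ω,
      (g x : EReal) ≤ (Eikonal.maxOpticalLength μ (closure Ω) f x y : EReal) + (g y : EReal)) :
    -- the infimum defining the function is finite on the closure of the domain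
    (∀ x ∈ closure Ω,
      (Eikonal.transversalMonge μ Ω f g x : EReal) = Eikonal.extValue μ Ω f g x) ∧
    (∀ v ∈ Eikonal.weakSubsolutions μ Ω f g, ∀ x ∈ closure Ω,
      v x ≤ Eikonal.transversalMonge μ Ω f g x) ∧
    ((∃ N ⊆ Ω, μ N = 0 ∧ UpperSemicontinuousOn f (Ω \ N)) →
      Eikonal.transversalMonge μ Ω f g ∈ Eikonal.weakSubsolutions μ Ω f g ∧
      ∀ x ∈ Ω, IsLUB {r : ℝ | ∃ v ∈ Eikonal.weakSubsolutions μ Ω f g, r = v x}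
        (Eikonal.transversalMonge μ Ω f g x)) := by
  obtain ⟨M, hM, hfM⟩ := Eikonal.exists_null_setOf_lt isClosed_closure hfL
  have hne : (frontier Ω).Nonempty :=
    haveI := hgeo.preconnectedSpace
    nonempty_frontier_iff.2 ⟨hΩc.nonempty, hΩX⟩
  have hμ0 : μ ≠ 0 := by
    obtain ⟨p, hp⟩ := hΩc.nonempty
    obtain ⟨q, hq⟩ := hne
    refine hfub.measure_ne_zero (subset_closure hp) (frontier_subset_closure hq) ?_
    rintro rfl
    rw [hΩo.frontier_eq] at hq
    exact hq.2 hp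
  have hL : ∀ x ∈ closure Ω, ∀ y ∈ closure Ω,
      Eikonal.maxOpticalLength μ (closure Ω) f x y ≤ ENNReal.ofReal (M * dist x y) :=
    fun x hx y hy => Eikonal.maxOpticalLength_le_of_forall_le hfub (sep_subset _ _) hfM hx hy
      (lt_add_one _) hM fun z hz _ => not_lt.1 fun h => hz.2 ⟨hz.1, h⟩
  have hfin : ∀ x ∈ closure Ω, ∀ y ∈ closure Ω,
      Eikonal.maxOpticalLength μ (closure Ω) f x y ≠ ∞ :=
    fun x hx y hy => ne_top_of_le_ne_top ENNReal.ofReal_ne_top (hL x hx y hy)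
  have hT : ∀ x ∈ closure Ω,
      (Eikonal.transversalMonge μ Ω f g x : EReal) = Eikonal.extValue μ Ω f g x :=
    fun x hx => Eikonal.coe_transversalMonge hne hfin hg hx
  have hcomp : ∀ v ∈ Eikonal.weakSubsolutions μ Ω f g, ∀ x ∈ closure Ω,
      v x ≤ Eikonal.transversalMonge μ Ω f g x := by
    obtain ⟨D, hDΩ, hDc, hD⟩ := hμ.exists_countable_dense_subset hμ0 hΩb.closure
    obtain ⟨N, hNΩ, hN0, hN⟩ :=
      Eikonal.exists_null_forall_maxOpticalLength_le hfub hM hfM hDΩ hDc hD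
    intro v hv x hx
    rw [Eikonal.le_transversalMonge_iff hfin hT hx]
    intro y hy
    rw [← sub_le_iff_le_add]
    exact (ENNReal.ofReal_le_iff_le_toReal (hfin x hx y (frontier_subset_closure hy))).1
      (Eikonal.ofReal_sub_le_maxOpticalLength hΩo hv hNΩ hN0 hN hg hy)
  refine ⟨hT, hcomp, ?_⟩
  rintro ⟨N, hNΩ, hN0, husc⟩
  have hlip : LipschitzOnWith M.toNNReal (Eikonal.transversalMonge μ Ω f g) (closure Ω) := by
    refine LipschitzOnWith.of_dist_le_mul fun x hx y hy => ?_
    rw [Real.coe_toNNReal M hM]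
    exact Eikonal.dist_transversalMonge_le hM hfin hT hx hy (hL x hx y hy)
      (dist_comm y x ▸ hL y hy x hx)
  have hmem : Eikonal.transversalMonge μ Ω f g ∈ Eikonal.weakSubsolutions μ Ω f g := by
    refine ⟨fun x _ => ⟨_, Ω, self_mem_nhdsWithin, hlip.mono subset_closure⟩, hlip.continuousOn,
      ?_, fun x hx => ?_⟩
    · rw [ae_restrict_iff' hΩo.measurableSet]
      filter_upwards [compl_mem_ae_iff.2 hN0] with x hxN hxΩ
      exact Eikonal.slope_transversalMonge_le hΩo hfub hfin hT hNΩ hN0 husc ⟨hxΩ, hxN⟩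
        (hfpos x (subset_closure hxΩ)).le
    · have hxc := frontier_subset_closure hx
      have h := (Eikonal.le_transversalMonge_iff hfin hT hxc).1 le_rfl x hx
      rwa [Eikonal.maxOpticalLength_self hxc, ENNReal.toReal_zero, zero_add] at h
  refine ⟨hmem, fun x hx => ⟨?_, fun b hb => hb ⟨_, hmem, rfl⟩⟩⟩
  rintro _ ⟨v, hv, rfl⟩
  exact hcomp v hv x (subset_closure hx)
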